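/- **Setting.** Let $\mathcal W$ be a finite set of workers and $\mathcal S$ a finite set of tasks, both fixed over time. Task $s_j$ has a type $z_j\in\{0,1,2\}$ (ride-share, battery swapping, V2G) and a start position $c_{s_j}$. Worker $w_i$ has a position $c_{w_i}$, energy per unit range $e_i$, remaining range $r_i$ and minimum range $r_i^{\min}$, and needs energy $l_{ij}$ for task $s_j$. Let $K\in\mathbb N$, let $\lambda$ be a proximity distance, let $|V2G|$ be the number of tasks of type $2$, and let $\psi=\lfloor |\mathcal W|K/|\mathcal S|\rfloor$. Let $\mathcal F$ be the set of matrices $\mathbf A=(a_{ij})\in\{0,1\}^{\mathcal W\times\mathcal S}$ such that $\sum_j a_{ij}\le K$ and $\sum_{j:z_j=2}a_{ij}\ge \frac{|V2G|}{|\mathcal S|}K$ for all $i$, $\sum_i a_{ij}\ge\psi$ for all $j$, $l_{ij}a_{ij}\le (r_i-r_i^{\min})e_i$ for all $i,j$, and $a_{ij}=0$ whenever $|c_{s_j}-c_{w_i}|>\lambda$. Assume that $\mathcal F$ is non-empty. For every worker $i$ and type $z$ there is an unknown preference variable with mean $\alpha_{iz}$. Its realisation $\bar\alpha_{iz}(t)$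 in round $t=1,2,\dots$ lies in $[0,1]$ and has mean $\alpha_{iz}$, and the vector $(\bar\alpha_{iz}(t))_{i,z}$ is independent of everything known before round $t$ (within one round the variables may be dependent). There are $Q=3|\mathcal W|$ preference variables. The reward of the action $\mathbf A(t)\in\mathcal F$ in round $t$ is $\sum_{i,j}a_{ij}(t)\,\bar\alpha_{iz_j}(t)$, with expectation $\mathbf R_{\mathbf A}=\sum_{i,j}a_{ij}\alpha_{iz_j}$ when $\mathbf A(t)=\mathbf A$ is fixed. Put $\mathbf R^*=\max_{\mathbf A\in\mathcal F}\mathbf R_{\mathbf A}$. **Algorithm CARS.** The variable $(i,z)$ is observed in a round if some task of type $z$ is recommended to worker $i$ in it, i.e. $a_{ij}=1$ for some $j$ with $z_j=z$. Let $m_{iz}$ be the number of rounds before round $t$ in which $(i,z)$ was observed, and $\widehat\alpha_{iz}$ the average of the values $\bar\alpha_{iz}$ observed in them. In round $t$ CARS plays $$\mathbf A(t)\in\arg\max_{\mathbf A\in\mathcal F}\ \sum_{i,j}a_{ij}\Big(\widehat\alpha_{iz_j}+\sqrt{\tfrac{(Q+1)\ln t}{m_{iz_j}}}\Big),$$ where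 the bracket is $+\infty$ if $m_{iz_j}=0$ (and $0\cdot\infty=0$), and ties are broken in any way that does not look into the future. **Theorem.** For every $t\ge1$ the cumulative regret $\mathcal R(t)=t\,\mathbf R^*-\mathbb E\big[\sum_{t'=1}^t\sum_{i,j}a_{ij}(t')\bar\alpha_{iz_j}(t')\big]$ of CARS satisfies $$\mathcal R(t)\le\left[\frac{4a_{\max}^2Q^3(Q+1)\ln t}{\Delta_{\min}^2}+\frac{\pi^2}{3}Q^2+Q\right]\Delta_{\max},$$ where $a_{\max}=\max_{\mathbf A\in\mathcal F}\max_{i,j}a_{ij}$, and $\Delta_{\min}$ and $\Delta_{\max}$ are the minimum and the maximum of $\mathbf R^*-\mathbf R_{\mathbf A}$ over all $\mathbf A\in\mathcal F$ with $\mathbf R_{\mathbf A}<\mathbf R^*$. (If every feasible action is optimal, the right-hand side is read as $0$.) -/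

import Mathlib

open MeasureTheory ProbabilityTheory

noncomputable section

namespace EUber

/-- A task `⟨z, c, d⟩`: its type (`0` ride-share, `1` battery swapping, `2` V2G), start position and
destination. -/
structure Task (P : Type*) where
  kind : Fin 3
  start : P
  dest : P

/-- A worker `⟨c, e, r, r^min⟩`: position, energy per unit range, remaining range and minimum
range. -/
structure Worker (P : Type*) where
  pos : P
  energyPerRange : ℝ
  range : ℝ
  minRange : ℝ

/-- The data of the task recommendation problem: workers, tasks, the energy `l i j` that worker `i`
needs for task `j`, the maximal list length `K` and the proximity distance. -/
structure Instance (W S P : Type*) where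
  worker : W → Worker P
  task : S → Task P
  l : W → S → ℝ
  K : ℕ
  proximity : ℝ

/-- An action matrix; its entries are forced to be `0` or `1` by feasibility. -/
abbrev Action (W S : Type*) := W → S → ℕ

/-- The indicator of the V2G type. -/
def g (z : Fin 3) : ℕ := if z = 2 then 1 else 0

variable {W S P Ω : Type*}

namespace Instance

/-- The number `|V2G|` of V2G tasks. -/
def numV2G [Fintype S] (I : Instance W S P) : ℕ := ∑ j, g (I.task j).kind

/-- `ψ = ⌊|W| K / |S|⌋` (division of natural numbers). -/
def psi [Fintype W] [Fintype S] (I : Instance W S P) : ℕ :=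
  Fintype.card W * I.K / Fintype.card S

/-- The constraints of the recommendation problem. -/
structure IsFeasible [Fintype W] [Fintype S] [PseudoMetricSpace P]
    (I : Instance W S P) (x : Action W S) : Prop where
  length_le : ∀ i, ∑ j, x i j ≤ I.K
  psi_le : ∀ j, I.psi ≤ ∑ i, x i j
  v2g_le : ∀ i, (I.numV2G : ℝ) / Fintype.card S * I.K ≤
    ((∑ j, g (I.task j).kind * x i j : ℕ) : ℝ)
  energy_le : ∀ i j, I.l i j * x i j ≤
    ((I.worker i).range - (I.worker i).minRange) * (I.worker i).energyPerRange
  near : ∀ i j, I.proximity < dist (I.task j).start (I.worker i).pos → x i j = 0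
  binary : ∀ i j, x i j = 0 ∨ x i j = 1

/-- The solution space `𝓕`. -/
def feasibleSet [Fintype W] [Fintype S] [PseudoMetricSpace P] (I : Instance W S P) :
    Set (Action W S) := {x | I.IsFeasible x}

/-- The reward `∑ a_ij v_{i z_j}` of an action for the preference values `v`. With the realised
preferences of a round it is the reward of that round, with their means it is the expected
reward. -/
def reward [Fintype W] [Fintype S] (I : Instance W S P) (v : W → Fin 3 → ℝ)
    (a : Action W S) : ℝ := ∑ i, ∑ j, (a i j : ℝ) * v i (I.task j).kind

/-- `R^*`, the largest expected reward of a feasible action (a maximum over a finite set). -/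
def optReward [Fintype W] [Fintype S] [PseudoMetricSpace P] (I : Instance W S P)
    (α : W → Fin 3 → ℝ) : ℝ := sSup (I.reward α '' I.feasibleSet)

/-- The (finite) set of the gaps `R^* - R_A` of the non-optimal feasible actions `A`. -/
def gaps [Fintype W] [Fintype S] [PseudoMetricSpace P] (I : Instance W S P)
    (α : W → Fin 3 → ℝ) : Set ℝ :=
  {d | ∃ a ∈ I.feasibleSet, I.reward α a < I.optReward α ∧ d = I.optReward α - I.reward α a}

/-- `Δ_min`. -/
def gapMin [Fintype W] [Fintype S] [PseudoMetricSpace P] (I : Instance W S P)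
    (α : W → Fin 3 → ℝ) : ℝ := sInf (I.gaps α)

/-- `Δ_max`. -/
def gapMax [Fintype W] [Fintype S] [PseudoMetricSpace P] (I : Instance W S P)
    (α : W → Fin 3 → ℝ) : ℝ := sSup (I.gaps α)

/-- `a_max`, the largest entry of a feasible action matrix. -/
def aMax [Fintype W] [Fintype S] [PseudoMetricSpace P] (I : Instance W S P) : ℝ :=
  sSup {r | ∃ a ∈ I.feasibleSet, ∃ i j, r = (a i j : ℝ)}

/-- The preference variable `(i, z)` is observed under `a`: a task of type `z` is recommended to
worker `i`. -/
def Observed (I : Instance W S P) (a : Action W S) (i : W) (z : Fin 3) : Prop :=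
  ∃ j, (I.task j).kind = z ∧ a i j = 1

open Classical in
/-- `m_{iz}(t)`: the number of observations of `(i, z)` in the rounds `1, …, t`, when the actions
are `a 1, a 2, …`. -/
def numObs (I : Instance W S P) (a : ℕ → Action W S) : ℕ → W → Fin 3 → ℕ
  | 0, _, _ => 0
  | t + 1, i, z => I.numObs a t i z + if I.Observed (a (t + 1)) i z then 1 else 0

open Classical in
/-- The estimate of the mean of `(i, z)` after round `t`, when the actions are `a 1, a 2, …` and the
realised preferences `x 1, x 2, …`. -/
def estimate (I : Instance W S P) (a : ℕ → Action W S) (x : ℕ → W → Fin 3 → ℝ) :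
    ℕ → W → Fin 3 → ℝ
  | 0, _, _ => 0
  | t + 1, i, z =>
    if I.Observed (a (t + 1)) i z then
      (I.estimate a x t i z * I.numObs a t i z + x (t + 1) i z) / (I.numObs a t i z + 1)
    else I.estimate a x t i z

end Instance

/-- `Q = |W| · 3`, the number of preference variables. -/
def numVars (W : Type*) [Fintype W] : ℕ := Fintype.card W * Fintype.card (Fin 3)

/-- The index of a variable with estimate `e` and `m` observations in round `t`; it is `+∞` as long
as the variable has not been observed. -/
def index (Q t : ℕ) (e : ℝ) (m : ℕ) : EReal :=
  if m = 0 then ⊤ else ((e + √(((Q : ℝ) + 1) * Real.log t / m) : ℝ) : EReal)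

/-- The objective `∑ a_ij (index of (i, z_j))` of CARS in round `t` (with `0 · ∞ = 0`). -/
def Instance.objective [Fintype W] [Fintype S] (I : Instance W S P) (t : ℕ)
    (e : W → Fin 3 → ℝ) (m : W → Fin 3 → ℕ) (a : Action W S) : EReal :=
  ∑ i, ∑ j, ((a i j : ℝ) : EReal) *
    index (numVars W) t (e i (I.task j).kind) (m i (I.task j).kind)

/-- The unknown environment. `X t i z` is the realised preference of worker `i` for type `z` in
round `t = 1, 2, …`; it lies in `[0, 1]`, has mean `α i z`, and the vector `X (t + 1)` is
independent of the information `ℱ t` available after round `t`, so that the vectors `X 1, X 2, …`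
are independent. Inside one round the preferences may depend on each other. -/
structure IsEnvironment [MeasurableSpace Ω] (μ : Measure Ω) (ℱ : Filtration ℕ ‹MeasurableSpace Ω›)
    (α : W → Fin 3 → ℝ) (X : ℕ → Ω → W → Fin 3 → ℝ) : Prop where
  adapted : ∀ t, Measurable[ℱ (t + 1)] (X (t + 1))
  mem_Icc : ∀ t ω i z, X (t + 1) ω i z ∈ Set.Icc (0 : ℝ) 1
  mean : ∀ t i z, ∫ ω, X (t + 1) ω i z ∂μ = α i z
  indep : ∀ t, Indep (MeasurableSpace.comap (X (t + 1)) inferInstance) (ℱ t) μ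

/-- `A 1, A 2, …` are the actions taken by CARS: the action of round `t + 1` depends only on the
information `ℱ t` and maximises over `𝓕` the objective computed from the observations of the rounds
`1, …, t`. Ties may be broken in any non-anticipating way. -/
structure IsCARS [Fintype W] [Fintype S] [PseudoMetricSpace P] [MeasurableSpace Ω]
    (I : Instance W S P) (ℱ : Filtration ℕ ‹MeasurableSpace Ω›)
    (X : ℕ → Ω → W → Fin 3 → ℝ) (A : ℕ → Ω → Action W S) : Prop where
  predictable : ∀ t, Measurable[ℱ t] (A (t + 1))
  feasible : ∀ t ω, A (t + 1) ω ∈ I.feasibleSet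
  maximal : ∀ t ω, ∀ b ∈ I.feasibleSet,
    I.objective (t + 1) (I.estimate (A · ω) (X · ω) t) (I.numObs (A · ω) t) b ≤
      I.objective (t + 1) (I.estimate (A · ω) (X · ω) t) (I.numObs (A · ω) t) (A (t + 1) ω)

/-- The cumulative regret `t R^* - 𝔼[∑_{s = 1}^t R_{A(s)}(s)]`. -/
def regret [Fintype W] [Fintype S] [PseudoMetricSpace P] [MeasurableSpace Ω]
    (I : Instance W S P) (μ : Measure Ω) (α : W → Fin 3 → ℝ)
    (X : ℕ → Ω → W → Fin 3 → ℝ) (A : ℕ → Ω → Action W S) (t : ℕ) : ℝ :=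
  t * I.optReward α - ∫ ω, ∑ s ∈ Finset.Icc 1 t, I.reward (X s ω) (A s ω) ∂μ

end EUber

end

/-!
The regret of CARS is the expected sum of the gaps of the actions played (`regret_eq_integral_sum`),
so it is enough to bound the expected number of suboptimal rounds and to multiply by `gapMax`.

*Optimality of the index rule.* A worker may receive many tasks of one type, so a direct comparison
of the indices of a suboptimal action with those of an optimal one accumulates more confidence
radii than the claimed bound allows. Instead, the selected action is compared with a neighbour. The
constraints are those of a flow problem: the difference of two feasible actions is a circulation in
a network whose vertices are the workers, the V2G parts of the workers, the tasks and a root. A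
circulation of positive reward contains a family of vertex-disjoint cycles of positive reward
(`IsCirculation.exists_cycleFlow_pos`). Moving an action along such cycles towards an optimal one
keeps it feasible, and costs each worker at most two tasks, one at each of her two vertices
(`exists_exchange`). Moving the optimal action back along them is feasible too, hence the reward
gained is the gap of a feasible action, at least `gapMin`. Maximality of the index sum says that the
indices see no gain, so the radii of the at most `2 |W| < Q` tasks given up have to make up for
`gapMin`. They cannot once the estimates are accurate and every recommended variable has been
observed at least `4 Q² (Q + 1) ln t / gapMin²` times (`Instance.optReward_le_of_maximal`).

*Counting.* Rounds that recommend a variable with fewer observations increase its count, so there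
are at most `Q (4 Q² (Q + 1) ln t / gapMin² + 1)` of them (`Instance.sum_observed_and_numObs_lt`).
The factor `aMax` in the claim is `1` as soon as some action is suboptimal.

*Concentration.* Whether a variable is observed in a round is decided by the past, and its value
is independent of the past. Hence the exponential of its accumulated deviation, compensated by
Hoeffding's lemma, is a supermartingale (`lintegral_expDeviation_le_one`). Markov's inequality for
each possible number of observations bounds by `2 / s²` the probability that an estimate used in
round `s` misses its confidence interval (`measureReal_badEvent_le`). Summed over the rounds and
the `Q` variables this gives `Q π² / 3 ≤ Q² π² / 3`.
-/

noncomputable section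

namespace EUber

/-! ### Circulations and their cycles -/

/-- An integral circulation on the complete directed graph with vertex set `V`: `F v w` is the net
flow from `v` to `w`. -/
structure IsCirculation {V : Type*} [Fintype V] (F : V → V → ℤ) : Prop where
  antisymm : ∀ v w, F w v = -F v w
  conserve : ∀ v, ∑ w, F v w = 0

/-- `C` is the unit flow along a non-empty family of vertex-disjoint directed cycles, all of whose
arcs carry positive flow in `F`. -/
structure IsCycleFlow {V : Type*} [Fintype V] (F C : V → V → ℤ) : Prop
    extends IsCirculation C where
  le_one : ∀ v w, C v w ≤ 1
  pos_of_pos : ∀ v w, 0 < C v w → 0 < F v w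
  in_unique : ∀ v v' w, 0 < C v w → 0 < C v' w → v = v'
  exists_pos : ∃ v w, 0 < C v w

section Circulation

variable {V : Type*} [Fintype V]

lemma IsCirculation.exists_pos_of_neg {F : V → V → ℤ} (hF : IsCirculation F) {v w : V}
    (h : F v w < 0) : ∃ u, 0 < F v u := by
  by_contra! hn
  have := Finset.sum_lt_sum (s := Finset.univ) (fun u _ => hn u) ⟨w, Finset.mem_univ _, h⟩
  simp [hF.conserve v] at this

lemma IsCirculation.sub {F G : V → V → ℤ} (hF : IsCirculation F) (hG : IsCirculation G) :
    IsCirculation (F - G) where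
  antisymm v w := by simp [hF.antisymm v w, hG.antisymm v w]; ring
  conserve v := by simp [Finset.sum_sub_distrib, hF.conserve v, hG.conserve v]

/-- A non-zero circulation contains a cycle flow: following arcs with positive flow never gets
stuck, so the map to the chosen successor has periodic points, which it permutes. -/
lemma IsCirculation.exists_cycleFlow {F : V → V → ℤ} (hF : IsCirculation F) (hne : F ≠ 0) :
    ∃ C, IsCycleFlow F C := by
  classical
  let T := {v : V // ∃ w, 0 < F v w}
  have hstep : ∀ v : T, ∃ w : T, 0 < F v w := by
    rintro ⟨v, w, hw⟩
    have : F w v < 0 := by rw [hF.antisymm v w]; omega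
    exact ⟨⟨w, hF.exists_pos_of_neg this⟩, hw⟩
  choose n hn using hstep
  have hT : Nonempty T := by
    by_contra hT
    refine hne (funext fun v => funext fun w => ?_)
    have h1 : ∀ v w, F v w ≤ 0 := fun v w => not_lt.1 fun h => hT ⟨⟨v, w, h⟩⟩
    have h2 := h1 v w
    have h3 := h1 w v
    rw [hF.antisymm v w] at h3
    simp only [Pi.zero_apply]; omega
  have hbij := Function.bijOn_periodicPts n
  let s : V → V → Prop := fun v w => ∃ p : T, p ∈ Function.periodicPts n ∧ p.1 = v ∧ (n p).1 = w
  have s_pos : ∀ {v w}, s v w → 0 < F v w := by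
    rintro v w ⟨p, -, rfl, rfl⟩; exact hn p
  have s_out : ∀ {v w w'}, s v w → s v w' → w = w' := by
    rintro v w w' ⟨p, -, rfl, rfl⟩ ⟨p', -, h, rfl⟩
    rw [Subtype.ext h]
  have s_in : ∀ {v v' w}, s v w → s v' w → v = v' := by
    rintro v v' w ⟨p, hp, rfl, rfl⟩ ⟨p', hp', rfl, h⟩
    rw [hbij.injOn hp' hp (Subtype.ext h)]
  have s_iff : ∀ v, (∃ w, s v w) ↔ ∃ w, s w v := by
    refine fun v => ⟨?_, ?_⟩
    · rintro ⟨w, p, hp, rfl, rfl⟩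
      obtain ⟨p', hp', h⟩ := hbij.surjOn hp
      exact ⟨p'.1, p', hp', rfl, congrArg _ h⟩
    · rintro ⟨w, p, hp, rfl, rfl⟩
      exact ⟨(n (n p)).1, n p, hbij.mapsTo hp, rfl, rfl⟩
  have key : ∀ {v w}, s v w → ¬ s w v := fun h h' => by
    have h1 := s_pos h
    have h2 := s_pos h'
    rw [hF.antisymm] at h2; omega
  let C : V → V → ℤ := fun v w => (if s v w then 1 else 0) - (if s w v then 1 else 0)
  have hC : ∀ v w, 0 < C v w ↔ s v w := by
    intro v w
    by_cases h : s v w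
    · simp [C, h, key h]
    · by_cases h' : s w v <;> simp [C, h, h']
  have hsum : ∀ (p : V → Prop) [DecidablePred p], (∀ w w', p w → p w' → w = w') →
      ∑ w, (if p w then (1 : ℤ) else 0) = if ∃ w, p w then 1 else 0 := by
    intro p _ hp
    by_cases h : ∃ w, p w
    · obtain ⟨w, hw⟩ := h
      have : ∀ x, p x ↔ x = w := fun x => ⟨fun hx => hp _ _ hx hw, fun hx => hx ▸ hw⟩
      simp [this]
    · rw [if_neg h]
      push Not at h
      simp [h]
  refine ⟨C, ⟨⟨fun v w => by simp [C], fun v => ?_⟩, fun v w => ?_, fun v w h => s_pos ((hC v w).1 h),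
    fun v v' w h h' => s_in ((hC v w).1 h) ((hC v' w).1 h'), ?_⟩⟩
  · simp only [C, Finset.sum_sub_distrib]
    rw [hsum (fun w => s v w) (fun _ _ => s_out), hsum (fun w => s w v) (fun _ _ => s_in)]
    simp only [s_iff v, sub_self]
  · simp only [C]
    split_ifs <;> simp
  · obtain ⟨p, hp⟩ : (Function.periodicPts n).Nonempty := by
      obtain ⟨x⟩ := hT
      obtain ⟨i, j, hij, h⟩ := Finite.exists_ne_map_eq_of_infinite (fun k : ℕ => n^[k] x)
      wlog hlt : i < j generalizing i j
      · exact this j i hij.symm h.symm (by omega)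
      refine ⟨n^[i] x, Function.mk_mem_periodicPts (n := j - i) (by omega) ?_⟩
      rw [Function.IsPeriodicPt, Function.IsFixedPt, ← Function.iterate_add_apply,
        Nat.sub_add_cancel hlt.le]
      exact h.symm
    exact ⟨p.1, (n p).1, (hC _ _).2 ⟨p, hp, rfl, rfl⟩⟩

/-- A cycle flow lies between zero and the circulation that contains it. -/
lemma IsCycleFlow.between {F C : V → V → ℤ} (hF : IsCirculation F) (hC : IsCycleFlow F C)
    (v w : V) : (0 ≤ C v w ∧ C v w ≤ F v w) ∨ (F v w ≤ C v w ∧ C v w ≤ 0) := by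
  have h1 := hC.le_one v w
  have h2 := hC.le_one w v
  have h3 := hC.pos_of_pos v w
  have h4 := hC.pos_of_pos w v
  rw [hC.antisymm v w] at h2 h4
  rw [hF.antisymm v w] at h4
  by_cases h : 0 < C v w
  · have := h3 h; omega
  · by_cases h' : 0 < -C v w
    · have := h4 h'; omega
    · by_cases h'' : 0 ≤ F v w <;> omega

/-- A circulation with positive value under an additive functional contains a cycle flow with
positive value: cycle flows with value at most zero can be subtracted. -/
lemma IsCirculation.exists_cycleFlow_pos (ρ : (V → V → ℤ) →+ ℝ) {F : V → V → ℤ}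
    (hF : IsCirculation F) (hρ : 0 < ρ F) : ∃ C, IsCycleFlow F C ∧ 0 < ρ C := by
  induction hN : ∑ v, ∑ w, (F v w).natAbs using Nat.strong_induction_on generalizing F with
  | _ N ih =>
    have hne : F ≠ 0 := by rintro rfl; simp at hρ
    obtain ⟨C, hC⟩ := hF.exists_cycleFlow hne
    rcases lt_or_ge 0 (ρ C) with h | h
    · exact ⟨C, hC, h⟩
    have hle : ∀ v w, ((F - C) v w).natAbs ≤ (F v w).natAbs := fun v w => by
      have := hC.between hF v w
      simp only [Pi.sub_apply]; omega
    obtain ⟨v₀, w₀, h₀⟩ := hC.exists_pos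
    have hlt : ∑ v, ∑ w, ((F - C) v w).natAbs < N := by
      rw [← hN]
      refine Finset.sum_lt_sum (fun v _ => Finset.sum_le_sum fun w _ => hle v w)
        ⟨v₀, Finset.mem_univ _, Finset.sum_lt_sum (fun w _ => hle v₀ w) ⟨w₀, Finset.mem_univ _, ?_⟩⟩
      have := hC.between hF v₀ w₀
      simp only [Pi.sub_apply]; omega
    obtain ⟨D, hD, hDρ⟩ := ih _ hlt (hF.sub hC.toIsCirculation) (by rw [map_sub]; linarith) rfl
    refine ⟨D, ⟨hD.toIsCirculation, hD.le_one, fun v w hvw => ?_, hD.in_unique, hD.exists_pos⟩, hDρ⟩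
    have h1 := hD.pos_of_pos v w hvw
    have := hC.between hF v w
    simp only [Pi.sub_apply] at h1; omega

end Circulation

/-! ### Exchanges between feasible actions -/

section

variable {W S P : Type*} [Fintype W] [Fintype S]

/-- The vertices of the exchange network: `inl (i, true)` collects the V2G tasks of worker `i` and
`inl (i, false)` all of her tasks, `inr (some j)` is task `j` and `inr none` is the root, which
closes the circulation. -/
abbrev Node (W S : Type*) := (W × Bool) ⊕ Option S

/-- The circulation of a difference `d` of two action matrices, where `k` marks the V2G tasks. The
arcs from the root to a worker, from a worker to her V2G vertex and from a task to the root carry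
the changes of the quantities that the constraints on the list length, the V2G share and the task
coverage bound. -/
def exchangeFlow [DecidableEq W] (k : S → Bool) (d : W → S → ℤ) : Node W S → Node W S → ℤ
  | .inl (i, b), .inr (some j) => if k j = b then d i j else 0
  | .inr (some j), .inl (i, b) => if k j = b then -d i j else 0
  | .inl (i, false), .inl (i', true) => if i = i' then ∑ j, (if k j then d i j else 0) else 0
  | .inl (i, true), .inl (i', false) => if i = i' then -∑ j, (if k j then d i j else 0) else 0
  | .inr none, .inl (i, false) => ∑ j, d i j
  | .inl (i, false), .inr none => -∑ j, d i j
  | .inr (some j), .inr none => ∑ i, d i j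
  | .inr none, .inr (some j) => -∑ i, d i j
  | _, _ => 0

lemma isCirculation_exchangeFlow [DecidableEq W] (k : S → Bool) (d : W → S → ℤ) :
    IsCirculation (exchangeFlow k d) where
  antisymm := by
    rintro (⟨i, _ | _⟩ | _ | j) (⟨i', _ | _⟩ | _ | j') <;>
      first
      | by_cases h : i = i'
        · subst h; simp [exchangeFlow]
        · simp [exchangeFlow, h, Ne.symm h]
      | simp [exchangeFlow]; split_ifs <;> simp
      | simp [exchangeFlow]
  conserve := by
    have h : ∀ i, ∑ j, (if k j = true then d i j else 0) + ∑ j, (if k j = false then d i j else 0) =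
        ∑ j, d i j := fun i => by
      rw [← Finset.sum_add_distrib]
      exact Finset.sum_congr rfl fun j _ => by cases k j <;> simp
    rintro (⟨i, _ | _⟩ | _ | j)
    · simp [exchangeFlow, Fintype.sum_sum_type, Fintype.sum_prod_type]
      linarith [h i]
    · simp [exchangeFlow, Fintype.sum_sum_type, Fintype.sum_prod_type]
    · simp only [exchangeFlow, Fintype.sum_sum_type, Fintype.sum_prod_type, Fintype.sum_option,
        Fintype.sum_bool]
      rw [Finset.sum_neg_distrib, Finset.sum_comm (s := (Finset.univ : Finset S))]
      simp
    · simp only [exchangeFlow, Fintype.sum_sum_type, Fintype.sum_prod_type, Fintype.sum_option,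
        Fintype.sum_bool]
      have : ∀ i, (if k j = true then -d i j else 0) + (if k j = false then -d i j else 0) =
          -d i j := fun i => by cases k j <;> simp
      simp [this]

section

variable [PseudoMetricSpace P]

/-- A matrix whose entries, row sums, column sums and V2G row sums are each no worse than those of
one of two feasible actions is feasible. -/
lemma Instance.IsFeasible.of_between {I : Instance W S P} {x y b : Action W S}
    (hx : I.IsFeasible x) (hy : I.IsFeasible y)
    (entry : ∀ i j, b i j = x i j ∨ b i j = y i j)
    (row : ∀ i, ∑ j, b i j ≤ ∑ j, x i j ∨ ∑ j, b i j ≤ ∑ j, y i j)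
    (col : ∀ j, ∑ i, x i j ≤ ∑ i, b i j ∨ ∑ i, y i j ≤ ∑ i, b i j)
    (v2g : ∀ i, ∑ j, g (I.task j).kind * x i j ≤ ∑ j, g (I.task j).kind * b i j ∨
      ∑ j, g (I.task j).kind * y i j ≤ ∑ j, g (I.task j).kind * b i j) :
    I.IsFeasible b where
  length_le i := (row i).elim (·.trans (hx.length_le i)) (·.trans (hy.length_le i))
  psi_le j := (col j).elim (hx.psi_le j).trans (hy.psi_le j).trans
  v2g_le i := (v2g i).elim (fun h => (hx.v2g_le i).trans (by exact_mod_cast h))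
    (fun h => (hy.v2g_le i).trans (by exact_mod_cast h))
  energy_le i j := (entry i j).elim (fun h => h ▸ hx.energy_le i j) (fun h => h ▸ hy.energy_le i j)
  near i j hd := (entry i j).elim (fun h => h ▸ hx.near i j hd) (fun h => h ▸ hy.near i j hd)
  binary i j := (entry i j).elim (fun h => h ▸ hx.binary i j) (fun h => h ▸ hy.binary i j)

/-- An action of larger reward can be approached by a small feasible exchange: part of the
difference can be moved from `a'` to `a` so that both actions stay feasible, the reward of `a`
grows, and `a` loses at most `2 |W|` tasks. The exchange is a cycle flow in the exchange network,
which takes at most one task from a worker at each of her two vertices. -/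
theorem exists_exchange (I : Instance W S P) (v : W → Fin 3 → ℝ) {a a' : Action W S}
    (ha : I.IsFeasible a) (ha' : I.IsFeasible a') (h : I.reward v a < I.reward v a') :
    ∃ b b' : Action W S, I.IsFeasible b ∧ I.IsFeasible b' ∧
      (∀ i j, b i j + b' i j = a i j + a' i j) ∧ I.reward v a < I.reward v b ∧
      (Finset.univ.filter fun p : W × S => b p.1 p.2 < a p.1 p.2).card ≤ 2 * Fintype.card W := by
  classical
  let k : S → Bool := fun j => decide ((I.task j).kind = 2)
  let d : W → S → ℤ := fun i j => (a' i j : ℤ) - a i j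
  have hF := isCirculation_exchangeFlow k d
  let ρ : (Node W S → Node W S → ℤ) →+ ℝ := AddMonoidHom.mk'
    (fun F => ∑ i, ∑ j, (F (.inl (i, k j)) (.inr (some j)) : ℝ) * v i (I.task j).kind) (by
      intro F G
      simp [add_mul, Finset.sum_add_distrib])
  have hρ : 0 < ρ (exchangeFlow k d) := by
    have : ρ (exchangeFlow k d) = I.reward v a' - I.reward v a := by
      simp [ρ, exchangeFlow, d, Instance.reward, sub_mul, Finset.sum_sub_distrib]
    linarith
  obtain ⟨C, hC, hCρ⟩ := hF.exists_cycleFlow_pos ρ hρ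
  have hbt := hC.between hF
  have hzero : ∀ x y, exchangeFlow k d x y = 0 → C x y = 0 := fun x y hxy => by
    have := hbt x y; omega
  let e : W → S → ℤ := fun i j => C (.inl (i, k j)) (.inr (some j))
  have hk : ∀ (c : Bool) i j, C (.inl (i, c)) (.inr (some j)) = if k j = c then e i j else 0 := by
    intro c i j
    split_ifs with h
    · rw [← h]
    · exact hzero _ _ (by simp [exchangeFlow, h])
  have hentry : ∀ i j, e i j = 0 ∨ e i j = d i j := fun i j => by
    have h1 := hbt (.inl (i, k j)) (.inr (some j))
    simp only [exchangeFlow, if_true] at h1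
    have h2 := ha.binary i j
    have h3 := ha'.binary i j
    simp only [e, d] at h1 ⊢
    omega
  have hv2g : ∀ i, C (.inl (i, false)) (.inl (i, true)) = ∑ j, (if k j then e i j else 0) := by
    intro i
    have h1 := hC.conserve (.inl (i, true))
    rw [Fintype.sum_sum_type, Fintype.sum_option, Fintype.sum_prod_type] at h1
    simp only [Fintype.sum_bool, hk] at h1
    rw [hzero (.inl (i, true)) (.inr none) (by simp [exchangeFlow])] at h1
    have h2 : ∀ i', C (.inl (i, true)) (.inl (i', true)) + C (.inl (i, true)) (.inl (i', false)) =
        if i = i' then C (.inl (i, true)) (.inl (i, false)) else 0 := fun i' => by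
      rw [hzero (.inl (i, true)) (.inl (i', true)) (by simp [exchangeFlow])]
      split_ifs with h
      · subst h; simp
      · rw [hzero (.inl (i, true)) (.inl (i', false)) (by simp [exchangeFlow, h])]; simp
    simp only [h2, Finset.sum_ite_eq, Finset.mem_univ, if_true] at h1
    rw [hC.antisymm (.inl (i, true))]
    linarith
  have hcol : ∀ j, C (.inr (some j)) (.inr none) = ∑ i, e i j := by
    intro j
    have h1 := hC.conserve (.inr (some j))
    rw [Fintype.sum_sum_type, Fintype.sum_option, Fintype.sum_prod_type] at h1
    have h2 : ∀ i, C (.inr (some j)) (.inl (i, true)) + C (.inr (some j)) (.inl (i, false)) =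
        -e i j := fun i => by
      rw [hC.antisymm (.inl (i, true)), hC.antisymm (.inl (i, false)), hk, hk]
      cases k j <;> simp
    have h3 : ∀ j', C (.inr (some j)) (.inr (some j')) = 0 :=
      fun j' => hzero _ _ (by simp [exchangeFlow])
    simp only [Fintype.sum_bool, h2, h3, Finset.sum_neg_distrib, Finset.sum_const_zero] at h1
    linarith
  have hrow : ∀ i, C (.inr none) (.inl (i, false)) = ∑ j, e i j := by
    intro i
    have h1 := hC.conserve (.inl (i, false))
    rw [Fintype.sum_sum_type, Fintype.sum_option, Fintype.sum_prod_type] at h1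
    have h2 : ∀ i', C (.inl (i, false)) (.inl (i', true)) + C (.inl (i, false)) (.inl (i', false)) =
        if i = i' then C (.inl (i, false)) (.inl (i, true)) else 0 := fun i' => by
      rw [hzero (.inl (i, false)) (.inl (i', false)) (by simp [exchangeFlow])]
      split_ifs with h
      · subst h; simp
      · rw [hzero (.inl (i, false)) (.inl (i', true)) (by simp [exchangeFlow, h])]; simp
    have h3 : ∑ j, (if k j = true then e i j else 0) + ∑ j, (if k j = false then e i j else 0) =
        ∑ j, e i j := by
      rw [← Finset.sum_add_distrib]
      exact Finset.sum_congr rfl fun j _ => by cases k j <;> simp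
    simp only [Fintype.sum_bool, h2, hk, Finset.sum_ite_eq, Finset.mem_univ, if_true, hv2g] at h1
    rw [hC.antisymm (.inl (i, false))]
    linarith
  let b : Action W S := fun i j => (a i j + e i j).toNat
  let b' : Action W S := fun i j => (a' i j - e i j).toNat
  have hb : ∀ i j, (b i j : ℤ) = a i j + e i j := fun i j => by
    have := hentry i j
    simp only [b, d] at this ⊢
    omega
  have hb' : ∀ i j, (b' i j : ℤ) = a' i j - e i j := fun i j => by
    have := hentry i j
    simp only [b', d] at this ⊢
    omega
  have hg : ∀ (i : W) (f : W → S → ℤ), ∑ j, (g (I.task j).kind : ℤ) * f i j =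
      ∑ j, if k j then f i j else 0 := fun i f => Finset.sum_congr rfl fun j _ => by
    simp [g, k]
  have row : ∀ i, (0 ≤ ∑ j, e i j ∧ ∑ j, e i j ≤ ∑ j, (a' i j : ℤ) - ∑ j, (a i j : ℤ)) ∨
      (∑ j, (a' i j : ℤ) - ∑ j, (a i j : ℤ) ≤ ∑ j, e i j ∧ ∑ j, e i j ≤ 0) := fun i => by
    have := hbt (.inr none) (.inl (i, false))
    simpa [hrow, exchangeFlow, d] using this
  have col : ∀ j, (0 ≤ ∑ i, e i j ∧ ∑ i, e i j ≤ ∑ i, (a' i j : ℤ) - ∑ i, (a i j : ℤ)) ∨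
      (∑ i, (a' i j : ℤ) - ∑ i, (a i j : ℤ) ≤ ∑ i, e i j ∧ ∑ i, e i j ≤ 0) := fun j => by
    have := hbt (.inr (some j)) (.inr none)
    simpa [hcol, exchangeFlow, d] using this
  have v2g : ∀ i, (0 ≤ ∑ j, (g (I.task j).kind : ℤ) * e i j ∧ ∑ j, (g (I.task j).kind : ℤ) * e i j ≤
        ∑ j, (g (I.task j).kind : ℤ) * a' i j - ∑ j, (g (I.task j).kind : ℤ) * a i j) ∨
      (∑ j, (g (I.task j).kind : ℤ) * a' i j - ∑ j, (g (I.task j).kind : ℤ) * a i j ≤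
        ∑ j, (g (I.task j).kind : ℤ) * e i j ∧ ∑ j, (g (I.task j).kind : ℤ) * e i j ≤ 0) := fun i => by
    have := hbt (.inl (i, false)) (.inl (i, true))
    rw [hv2g, ← hg] at this
    simp only [exchangeFlow, if_true, ← hg] at this
    simpa [d, mul_sub] using this
  refine ⟨b, b', ?_, ?_, fun i j => ?_, ?_, ?_⟩
  · refine ha.of_between ha' (fun i j => ?_) (fun i => ?_) (fun j => ?_) (fun i => ?_)
    · have := hentry i j
      have := hb i j
      simp only [d] at *
      omega
    · zify; simp only [hb, Finset.sum_add_distrib]; have := row i; omega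
    · zify; simp only [hb, Finset.sum_add_distrib]; have := col j; omega
    · zify; simp only [hb, mul_add, Finset.sum_add_distrib]; have := v2g i; omega
  · refine ha.of_between ha' (fun i j => ?_) (fun i => ?_) (fun j => ?_) (fun i => ?_)
    · have := hentry i j
      have := hb' i j
      simp only [d] at *
      omega
    · zify; simp only [hb', Finset.sum_sub_distrib]; have := row i; omega
    · zify; simp only [hb', Finset.sum_sub_distrib]; have := col j; omega
    · zify; simp only [hb', mul_sub, Finset.sum_sub_distrib]; have := v2g i; omega
  · have := hb i j
    have := hb' i j
    omega
  · have h1 : ∀ i j, (b i j : ℝ) = a i j + e i j := fun i j => by exact_mod_cast hb i j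
    have : I.reward v b = I.reward v a + ρ C := by
      simp [ρ, Instance.reward, h1, add_mul, Finset.sum_add_distrib, e]
    linarith
  · have hcard : 2 * Fintype.card W = (Finset.univ : Finset (W × Bool)).card := by
      simp [mul_comm]
    rw [hcard]
    refine Finset.card_le_card_of_injOn (fun p => (p.1, k p.2)) (by simp) ?_
    rintro ⟨i, j⟩ hp ⟨i', j'⟩ hp' heq
    simp only [Finset.coe_filter, Finset.mem_univ, true_and, Set.mem_ofPred_eq] at hp hp'
    obtain ⟨rfl, hkk⟩ := Prod.mk.inj heq
    have aux : ∀ j, b i j < a i j → 0 < C (.inr (some j)) (.inl (i, k j)) := fun j hj => by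
      have := hb i j
      rw [hC.antisymm]
      simp only [e] at this; omega
    -- The tasks `j` and `j'` both send flow into the vertex `(i, k j)`.
    have h1 := aux j hp
    rw [show k j = k j' from hkk] at h1
    simpa using hC.in_unique _ _ _ h1 (aux j' hp')

end

end

/-! ### The index rule under accurate estimates -/

section

variable {W S P : Type*} [Fintype W] [Fintype S]

lemma ereal_sum_ne_bot {ι : Type*} (s : Finset ι) {f : ι → EReal} (h : ∀ i ∈ s, f i ≠ ⊥) :
    ∑ i ∈ s, f i ≠ ⊥ := by
  classical
  induction s using Finset.induction_on with
  | empty => simp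
  | insert i s hi ih =>
    rw [Finset.sum_insert hi]
    simp only [Finset.mem_insert, forall_eq_or_imp] at h
    simpa [EReal.add_eq_bot_iff] using ⟨h.1, ih h.2⟩

lemma ereal_sum_eq_top {ι : Type*} [Fintype ι] {f : ι → EReal} (h : ∀ i, f i ≠ ⊥) (i : ι)
    (hi : f i = ⊤) : ∑ i, f i = ⊤ := by
  classical
  rw [← Finset.add_sum_erase _ _ (Finset.mem_univ i), hi]
  exact EReal.top_add_of_ne_bot (ereal_sum_ne_bot _ fun j _ => h j)

lemma ereal_coe_sum {ι : Type*} (s : Finset ι) (f : ι → ℝ) :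
    ((∑ i ∈ s, f i : ℝ) : EReal) = ∑ i ∈ s, (f i : EReal) :=
  map_sum (⟨⟨Real.toEReal, EReal.coe_zero⟩, EReal.coe_add⟩ : ℝ →+ EReal) f s

/-- The objective of an action that recommends no unobserved variable is finite. -/
lemma Instance.objective_eq_coe (I : Instance W S P) (t : ℕ) (e : W → Fin 3 → ℝ)
    (m : W → Fin 3 → ℕ) (a : Action W S) (h : ∀ i j, a i j ≠ 0 → m i (I.task j).kind ≠ 0) :
    I.objective t e m a = (I.reward
      (fun i z => e i z + √(((numVars W : ℝ) + 1) * Real.log t / m i z)) a : ℝ) := by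
  simp only [objective, reward, ereal_coe_sum]
  refine Finset.sum_congr rfl fun i _ => Finset.sum_congr rfl fun j _ => ?_
  by_cases ha : a i j = 0
  · simp [ha]
  · rw [index, if_neg (h i j ha), ← EReal.coe_mul]

lemma Instance.observed_of_objective_ne_top (I : Instance W S P) (t : ℕ) (e : W → Fin 3 → ℝ)
    (m : W → Fin 3 → ℕ) (a : Action W S) (h : I.objective t e m a ≠ ⊤) (i : W) (j : S)
    (ha : a i j ≠ 0) : m i (I.task j).kind ≠ 0 := by
  intro hm
  have hbot : ∀ i j, ((a i j : ℝ) : EReal) *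
      index (numVars W) t (e i (I.task j).kind) (m i (I.task j).kind) ≠ ⊥ := by
    intro i j
    rcases Nat.eq_zero_or_pos (a i j) with h0 | h0
    · simp [h0]
    · unfold index
      split_ifs
      · rw [EReal.coe_mul_top_of_pos (by exact_mod_cast h0)]; simp
      · rw [← EReal.coe_mul]; exact EReal.coe_ne_bot _
  refine h (ereal_sum_eq_top (fun i => ereal_sum_ne_bot _ fun j _ => hbot i j) i
    (ereal_sum_eq_top (hbot i) j ?_))
  rw [index, if_pos hm, EReal.coe_mul_top_of_pos]
  exact_mod_cast Nat.pos_of_ne_zero ha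

section

variable [PseudoMetricSpace P]

lemma Instance.finite_feasibleSet (I : Instance W S P) : I.feasibleSet.Finite := by
  classical
  refine (Set.finite_Icc (0 : Action W S) (fun _ _ => 1)).subset fun x hx => ⟨?_, fun i j => ?_⟩
  · intro i j; simp
  · rcases hx.binary i j with h | h <;> simp [h]

lemma Instance.finite_gaps (I : Instance W S P) (α : W → Fin 3 → ℝ) : (I.gaps α).Finite := by
  refine (I.finite_feasibleSet.image fun a => I.optReward α - I.reward α a).subset ?_
  rintro d ⟨a, ha, -, rfl⟩
  exact ⟨a, ha, rfl⟩

lemma Instance.reward_le_optReward (I : Instance W S P) (α : W → Fin 3 → ℝ) {a : Action W S}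
    (ha : a ∈ I.feasibleSet) : I.reward α a ≤ I.optReward α :=
  le_csSup (I.finite_feasibleSet.image _).bddAbove ⟨a, ha, rfl⟩

lemma Instance.exists_reward_eq_optReward (I : Instance W S P) (α : W → Fin 3 → ℝ)
    (h : I.feasibleSet.Nonempty) : ∃ a ∈ I.feasibleSet, I.reward α a = I.optReward α :=
  (h.image _).csSup_mem (I.finite_feasibleSet.image _)

lemma Instance.gapMin_pos (I : Instance W S P) (α : W → Fin 3 → ℝ) (h : (I.gaps α).Nonempty) :
    0 < I.gapMin α := by
  obtain ⟨a, -, h1, h2⟩ := h.csInf_mem (I.finite_gaps α)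
  rw [gapMin, h2]; linarith

lemma Instance.gapMin_le (I : Instance W S P) (α : W → Fin 3 → ℝ) {a : Action W S}
    (ha : a ∈ I.feasibleSet) (h : I.reward α a < I.optReward α) :
    I.gapMin α ≤ I.optReward α - I.reward α a :=
  csInf_le (I.finite_gaps α).bddBelow ⟨a, ha, h, rfl⟩

lemma Instance.le_gapMax (I : Instance W S P) (α : W → Fin 3 → ℝ) {a : Action W S}
    (ha : a ∈ I.feasibleSet) (h : I.reward α a < I.optReward α) :
    I.optReward α - I.reward α a ≤ I.gapMax α :=
  le_csSup (I.finite_gaps α).bddAbove ⟨a, ha, h, rfl⟩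

lemma Instance.aMax_eq_one (I : Instance W S P) (α : W → Fin 3 → ℝ) (h : (I.gaps α).Nonempty) :
    I.aMax = 1 := by
  obtain ⟨-, a, ha, hlt, -⟩ := h
  obtain ⟨a', ha', heq⟩ := I.exists_reward_eq_optReward α ⟨a, ha⟩
  have hex : ∃ x ∈ I.feasibleSet, ∃ i j, x i j ≠ 0 := by
    by_contra! hn
    have : a = a' := by
      funext i j; rw [hn a ha, hn a' ha']
    rw [this, heq] at hlt
    exact lt_irrefl _ hlt
  obtain ⟨x, hx, i, j, hxij⟩ := hex
  refine IsGreatest.csSup_eq ⟨⟨x, hx, i, j, ?_⟩, ?_⟩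
  · rw [(hx.binary i j).resolve_left hxij]; simp
  · rintro r ⟨y, hy, i, j, rfl⟩
    rcases hy.binary i j with h | h <;> simp [h]

/-- The index rule selects an optimal action as soon as every estimate is within its confidence
radius and every variable that the selected action recommends has been observed sufficiently often.
A suboptimal action would admit an exchange that gains at least `gapMin`, but the indices credit it
with no gain, and they overestimate the means of the at most `2 |W|` tasks given up by less than
`gapMin` in total. -/
theorem Instance.optReward_le_of_maximal (I : Instance W S P) (α e : W → Fin 3 → ℝ)
    (m : W → Fin 3 → ℕ) (t : ℕ) {a : Action W S} (ha : a ∈ I.feasibleSet)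
    (hmax : ∀ b ∈ I.feasibleSet, I.objective t e m b ≤ I.objective t e m a)
    (hobs : ∀ i z, I.Observed a i z → m i z ≠ 0 ∧
      4 * (numVars W : ℝ) ^ 2 * ((numVars W : ℝ) + 1) * Real.log t / I.gapMin α ^ 2 ≤ m i z)
    (hgood : ∀ i z, m i z ≠ 0 →
      |e i z - α i z| ≤ √(((numVars W : ℝ) + 1) * Real.log t / m i z)) :
    I.optReward α ≤ I.reward α a := by
  by_contra! hlt
  obtain ⟨a', ha', heq⟩ := I.exists_reward_eq_optReward α ⟨a, ha⟩
  obtain ⟨b, b', hb, hb', hsum, hgain, hcard⟩ := exists_exchange I α ha ha' (heq ▸ hlt)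
  have hΔ : 0 < I.gapMin α := I.gapMin_pos α ⟨_, a, ha, hlt, rfl⟩
  -- The exchange turns an optimal action into `b'`, so its gain is the gap of `b'`.
  have hgap : I.gapMin α ≤ I.reward α b - I.reward α a := by
    have h1 : I.reward α b + I.reward α b' = I.reward α a + I.reward α a' := by
      simp only [reward, ← Finset.sum_add_distrib, ← add_mul]
      refine Finset.sum_congr rfl fun i _ => Finset.sum_congr rfl fun j _ => ?_
      congr 1
      exact_mod_cast hsum i j
    have := I.gapMin_le α hb' (by linarith)
    linarith
  have hma : ∀ i j, a i j ≠ 0 → m i (I.task j).kind ≠ 0 := fun i j h =>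
    (hobs i _ ⟨j, rfl, (ha.binary i j).resolve_left h⟩).1
  have hmb : ∀ i j, b i j ≠ 0 → m i (I.task j).kind ≠ 0 := by
    refine I.observed_of_objective_ne_top t e m b (ne_top_of_le_ne_top ?_ (hmax b hb))
    rw [I.objective_eq_coe t e m a hma]
    exact EReal.coe_ne_top _
  have hle := hmax b hb
  rw [I.objective_eq_coe t e m a hma, I.objective_eq_coe t e m b hmb, EReal.coe_le_coe_iff] at hle
  set U : W → Fin 3 → ℝ := fun i z => e i z + √(((numVars W : ℝ) + 1) * Real.log t / m i z) with hU
  set c : ℝ := I.gapMin α / numVars W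
  have hentry : ∀ i j, ((b i j : ℝ) - a i j) * α i (I.task j).kind ≤
      ((b i j : ℝ) - a i j) * U i (I.task j).kind + if b i j < a i j then c else 0 := by
    intro i j
    set z := (I.task j).kind
    have hQ : (0 : ℝ) < numVars W := by
      have : 0 < Fintype.card W := Fintype.card_pos_iff.2 ⟨i⟩
      simp only [numVars, Fintype.card_fin]; positivity
    rcases ha.binary i j with h0 | h0 <;> rcases hb.binary i j with h1 | h1 <;> simp only [h0, h1]
    · simp
    · have := abs_le.1 (hgood i z (hmb i j (by omega)))
      simp only [hU]
      generalize √(((numVars W : ℝ) + 1) * Real.log t / m i z) = r at this ⊢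
      norm_num
      linarith [this.1]
    · obtain ⟨hm, hl⟩ := hobs i z ⟨j, rfl, h0⟩
      have hm' : (0 : ℝ) < m i z := by exact_mod_cast Nat.pos_of_ne_zero hm
      have hr : √(((numVars W : ℝ) + 1) * Real.log t / m i z) ≤ c / 2 := by
        refine Real.sqrt_le_iff.2 ⟨by positivity, ?_⟩
        rw [div_le_iff₀ (by positivity)] at hl
        simp only [c]
        rw [div_pow, div_pow, div_div, div_le_div_iff₀ hm' (by positivity)]
        linarith
      have := abs_le.1 (hgood i z hm)
      simp only [hU]
      generalize √(((numVars W : ℝ) + 1) * Real.log t / m i z) = r at this hr ⊢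
      norm_num
      linarith [this.2]
    · simp
  have htotal : I.reward α b - I.reward α a ≤ I.reward U b - I.reward U a +
      (Finset.univ.filter fun p : W × S => b p.1 p.2 < a p.1 p.2).card * c := by
    have h1 : ∀ v, I.reward v b - I.reward v a =
        ∑ p : W × S, ((b p.1 p.2 : ℝ) - a p.1 p.2) * v p.1 (I.task p.2).kind := fun v => by
      simp only [reward, Fintype.sum_prod_type, sub_mul, Finset.sum_sub_distrib]
    rw [h1, h1, ← nsmul_eq_mul, ← Finset.sum_const, Finset.sum_filter, ← Finset.sum_add_distrib]
    exact Finset.sum_le_sum fun p _ => hentry p.1 p.2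
  have hc : 0 ≤ c := by positivity
  have hcard' : ((Finset.univ.filter fun p : W × S => b p.1 p.2 < a p.1 p.2).card : ℝ) ≤
      2 * Fintype.card W := by exact_mod_cast hcard
  have hlast : 2 * (Fintype.card W : ℝ) * c < I.gapMin α := by
    rcases Nat.eq_zero_or_pos (Fintype.card W) with h | h
    · simpa [h] using hΔ
    · have h' : (0 : ℝ) < Fintype.card W := by exact_mod_cast h
      have : 2 * (Fintype.card W : ℝ) * c = 2 / 3 * I.gapMin α := by
        simp only [c, numVars, Fintype.card_fin]; push_cast; field_simp
      linarith
  have := mul_le_mul_of_nonneg_right hcard' hc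
  linarith

end

end

/-! ### Concentration of the estimates -/

section

variable {W S P Ω : Type*}

open Classical in
/-- The accumulated deviation of the observations of `(i, z)` from `c` grows by the deviation of
the new observation. -/
lemma Instance.numObs_mul_estimate_sub_succ (I : Instance W S P) (a : ℕ → Action W S)
    (x : ℕ → W → Fin 3 → ℝ) (c : ℝ) (t : ℕ) (i : W) (z : Fin 3) :
    I.numObs a (t + 1) i z * (I.estimate a x (t + 1) i z - c) =
      I.numObs a t i z * (I.estimate a x t i z - c) +
        if I.Observed (a (t + 1)) i z then x (t + 1) i z - c else 0 := by
  simp only [numObs, estimate]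
  split_ifs
  · push_cast
    have : (I.numObs a t i z : ℝ) + 1 ≠ 0 := by positivity
    field_simp
    ring
  · simp

lemma Instance.numObs_le (I : Instance W S P) (a : ℕ → Action W S) (t : ℕ) (i : W) (z : Fin 3) :
    I.numObs a t i z ≤ t := by
  induction t with
  | zero => simp [numObs]
  | succ t ih => simp only [numObs]; split_ifs <;> omega

section

variable [Fintype W] [Fintype S] [MeasurableSpace Ω]

variable {μ : Measure Ω} {I : Instance W S P} {ℱ : Filtration ℕ ‹MeasurableSpace Ω›}
  {α : W → Fin 3 → ℝ} {X : ℕ → Ω → W → Fin 3 → ℝ} {A : ℕ → Ω → Action W S}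

lemma measurableSet_observed (hA : ∀ t, Measurable[ℱ t] (A (t + 1))) (t : ℕ) (i : W) (z : Fin 3) :
    MeasurableSet[ℱ t] {ω | I.Observed (A (t + 1) ω) i z} :=
  hA t (MeasurableSet.of_discrete (s := {a : Action W S | I.Observed a i z}))

lemma measurable_numObs (hA : ∀ t, Measurable[ℱ t] (A (t + 1))) (t : ℕ) (i : W) (z : Fin 3) :
    Measurable[ℱ t] fun ω => I.numObs (A · ω) t i z := by
  induction t with
  | zero => exact measurable_const
  | succ t ih =>
    refine Measurable.mono (ma := ℱ t) (mb := ⊤) ?_ (ℱ.mono t.le_succ) le_rfl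
    exact Measurable.add ih
      (Measurable.ite (measurableSet_observed hA t i z) measurable_const measurable_const)

lemma measurable_estimate (hA : ∀ t, Measurable[ℱ t] (A (t + 1)))
    (hX : ∀ t, Measurable[ℱ (t + 1)] (X (t + 1))) (t : ℕ) (i : W) (z : Fin 3) :
    Measurable[ℱ t] fun ω => I.estimate (A · ω) (X · ω) t i z := by
  induction t with
  | zero => exact measurable_const
  | succ t ih =>
    have h1 : Measurable[ℱ (t + 1)] fun ω => I.estimate (A · ω) (X · ω) t i z :=
      ih.mono (ℱ.mono t.le_succ) le_rfl
    have h2 : Measurable[ℱ (t + 1)] fun ω => (I.numObs (A · ω) t i z : ℝ) :=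
      (measurable_from_top (f := ((↑) : ℕ → ℝ))).comp
        ((measurable_numObs hA t i z).mono (ℱ.mono t.le_succ) le_rfl)
    have h3 : Measurable[ℱ (t + 1)] fun ω => X (t + 1) ω i z :=
      (measurable_pi_apply z).comp ((measurable_pi_apply i).comp (hX t))
    exact Measurable.ite (ℱ.mono t.le_succ _ (measurableSet_observed hA t i z))
      (((h1.mul h2).add h3).div (h2.add_const 1)) h1

/-- The exponential of the accumulated deviation of the observations of `(i, z)`, compensated by
Hoeffding's bound for its moment generating function. -/
def expDeviation (I : Instance W S P) (α : W → Fin 3 → ℝ) (X : ℕ → Ω → W → Fin 3 → ℝ)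
    (A : ℕ → Ω → Action W S) (i : W) (z : Fin 3) (r : ℝ) (t : ℕ) (ω : Ω) : ℝ :=
  Real.exp (r * (I.numObs (A · ω) t i z * (I.estimate (A · ω) (X · ω) t i z - α i z)) -
    r ^ 2 / 8 * I.numObs (A · ω) t i z)

lemma measurable_expDeviation (hA : ∀ t, Measurable[ℱ t] (A (t + 1)))
    (hX : ∀ t, Measurable[ℱ (t + 1)] (X (t + 1))) (i : W) (z : Fin 3) (r : ℝ) (t : ℕ) :
    Measurable[ℱ t] (expDeviation I α X A i z r t) := by
  have h2 : Measurable[ℱ t] fun ω => (I.numObs (A · ω) t i z : ℝ) :=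
    (measurable_from_top (f := ((↑) : ℕ → ℝ))).comp (measurable_numObs hA t i z)
  exact Real.measurable_exp.comp
    (((h2.mul ((measurable_estimate hA hX t i z).sub_const _)).const_mul r).sub (h2.const_mul _))

omit [Fintype W] in
/-- Hoeffding's lemma for the preference values of one round. -/
lemma IsEnvironment.lintegral_exp_le_one [IsProbabilityMeasure μ] (hX : IsEnvironment μ ℱ α X)
    (t : ℕ) (i : W) (z : Fin 3) (r : ℝ) :
    ∫⁻ ω, ENNReal.ofReal (Real.exp (r * (X (t + 1) ω i z - α i z) - r ^ 2 / 8)) ∂μ ≤ 1 := by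
  have hm : Measurable fun ω => X (t + 1) ω i z :=
    (measurable_pi_apply z).comp
      ((measurable_pi_apply i).comp ((hX.adapted t).mono (ℱ.le _) le_rfl))
  have h := hasSubgaussianMGF_of_mem_Icc (μ := μ) hm.aemeasurable
    (.of_forall fun ω => hX.mem_Icc t ω i z)
  rw [hX.mean] at h
  have hle := h.mgf_le r
  rw [← ofReal_integral_eq_lintegral_ofReal
    (by simpa [Real.exp_sub] using (h.integrable_exp_mul r).div_const _)
    (.of_forall fun ω => (Real.exp_pos _).le)]
  rw [ENNReal.ofReal_le_one]
  simp only [Real.exp_sub, integral_div]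
  rw [div_le_one (Real.exp_pos _)]
  refine hle.trans (Real.exp_le_exp.2 (le_of_eq ?_))
  norm_num
  ring

/-- The compensated exponential is a supermartingale started at `1`: whether `(i, z)` is observed
in a round is decided by the past, which is independent of its value in that round. -/
lemma lintegral_expDeviation_le_one [IsProbabilityMeasure μ] (hX : IsEnvironment μ ℱ α X)
    (hA : ∀ t, Measurable[ℱ t] (A (t + 1))) (i : W) (z : Fin 3) (r : ℝ) (t : ℕ) :
    ∫⁻ ω, ENNReal.ofReal (expDeviation I α X A i z r t ω) ∂μ ≤ 1 := by
  classical
  induction t with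
  | zero => simp [expDeviation, Instance.numObs]
  | succ t ih =>
    set Z : Ω → ENNReal := fun ω => ENNReal.ofReal (expDeviation I α X A i z r t ω)
    set G : Ω → ENNReal := fun ω =>
      ENNReal.ofReal (Real.exp (r * (X (t + 1) ω i z - α i z) - r ^ 2 / 8))
    set O : Set Ω := {ω | I.Observed (A (t + 1) ω) i z}
    have hO : MeasurableSet[ℱ t] O := measurableSet_observed hA t i z
    have hZ : Measurable[ℱ t] Z :=
      ENNReal.measurable_ofReal.comp (measurable_expDeviation hA hX.adapted i z r t)
    have hG : Measurable[MeasurableSpace.comap (X (t + 1)) inferInstance] G := by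
      have : Measurable fun x : W → Fin 3 → ℝ =>
          ENNReal.ofReal (Real.exp (r * (x i z - α i z) - r ^ 2 / 8)) := by fun_prop
      exact this.comp (comap_measurable _)
    have hstep : ∀ ω, ENNReal.ofReal (expDeviation I α X A i z r (t + 1) ω) =
        O.indicator Z ω * G ω + Oᶜ.indicator Z ω := by
      intro ω
      simp only [expDeviation, Instance.numObs_mul_estimate_sub_succ]
      by_cases h : I.Observed (A (t + 1) ω) i z
      · have h' : ω ∈ O := h
        simp only [Instance.numObs, h, if_true, h', Set.indicator_of_mem, Set.mem_compl_iff,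
          not_true_eq_false, not_false_eq_true, Set.indicator_of_notMem, add_zero, Z, G,
          expDeviation]
        rw [← ENNReal.ofReal_mul (Real.exp_pos _).le, ← Real.exp_add]
        congr 2
        push_cast
        ring
      · have h' : ω ∉ O := h
        simp [Instance.numObs, h, h', Z, expDeviation]
    calc ∫⁻ ω, ENNReal.ofReal (expDeviation I α X A i z r (t + 1) ω) ∂μ
        = ∫⁻ ω, O.indicator Z ω * G ω ∂μ + ∫⁻ ω, Oᶜ.indicator Z ω ∂μ := by
          simp_rw [hstep]
          exact lintegral_add_right _ ((hZ.indicator hO.compl).mono (ℱ.le t) le_rfl)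
      _ = (∫⁻ ω, O.indicator Z ω ∂μ) * ∫⁻ ω, G ω ∂μ + ∫⁻ ω, Oᶜ.indicator Z ω ∂μ := by
          rw [lintegral_mul_eq_lintegral_mul_lintegral_of_independent_measurableSpace (ℱ.le t)
            ((hX.adapted t).mono (ℱ.le _) le_rfl).comap_le (hX.indep t).symm
            (hZ.indicator hO) hG]
      _ ≤ (∫⁻ ω, O.indicator Z ω ∂μ) * 1 + ∫⁻ ω, Oᶜ.indicator Z ω ∂μ := by
          gcongr
          exact hX.lintegral_exp_le_one t i z r
      _ = ∫⁻ ω, Z ω ∂μ := by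
          rw [mul_one, lintegral_indicator (ℱ.le t _ hO), lintegral_indicator (ℱ.le t _ hO.compl)]
          exact lintegral_add_compl _ (ℱ.le t _ hO)
      _ ≤ 1 := ih

/-- The event that the estimate of `(i, z)` after round `t` misses its mean by more than the
confidence radius of round `t + 1`. -/
def badEvent (I : Instance W S P) (α : W → Fin 3 → ℝ) (X : ℕ → Ω → W → Fin 3 → ℝ)
    (A : ℕ → Ω → Action W S) (t : ℕ) (i : W) (z : Fin 3) : Set Ω :=
  {ω | I.numObs (A · ω) t i z ≠ 0 ∧
    √(((numVars W : ℝ) + 1) * Real.log (t + 1 : ℕ) / I.numObs (A · ω) t i z) <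
      |I.estimate (A · ω) (X · ω) t i z - α i z|}

lemma measurableSet_badEvent (hA : ∀ t, Measurable[ℱ t] (A (t + 1)))
    (hX : ∀ t, Measurable[ℱ (t + 1)] (X (t + 1))) (t : ℕ) (i : W) (z : Fin 3) :
    MeasurableSet (badEvent I α X A t i z) := by
  have h1 : Measurable fun ω => I.numObs (A · ω) t i z :=
    (measurable_numObs hA t i z).mono (ℱ.le t) le_rfl
  have h2 : Measurable fun ω => (I.numObs (A · ω) t i z : ℝ) :=
    (measurable_from_top (f := ((↑) : ℕ → ℝ))).comp h1
  have h3 : Measurable fun ω => I.estimate (A · ω) (X · ω) t i z :=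
    (measurable_estimate hA hX t i z).mono (ℱ.le t) le_rfl
  exact (h1 (measurableSet_singleton 0)).compl.inter
    (measurableSet_lt (measurable_const.div h2).sqrt (h3.sub_const _).abs)

/-- A deviation bound for a fixed number `k` of observations: on the bad event one of the two
compensated exponentials with the optimal parameters `± 4 ε / k`, where `ε / k` is the confidence
radius, is large. -/
lemma measureReal_badEvent_inter_le [IsProbabilityMeasure μ] (hX : IsEnvironment μ ℱ α X)
    (hA : ∀ t, Measurable[ℱ t] (A (t + 1))) (t : ℕ) (i : W) (z : Fin 3) (k : ℕ) (hk : k ≠ 0) :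
    μ.real (badEvent I α X A t i z ∩ {ω | I.numObs (A · ω) t i z = k}) ≤
      2 * Real.exp (-(2 * (((numVars W : ℝ) + 1) * Real.log (t + 1 : ℕ)))) := by
  set L : ℝ := ((numVars W : ℝ) + 1) * Real.log (t + 1 : ℕ)
  have hL : 0 ≤ L := mul_nonneg (by positivity) (Real.log_natCast_nonneg _)
  have hk' : (0 : ℝ) < k := by exact_mod_cast Nat.pos_of_ne_zero hk
  set r : ℝ := 4 * √(L / k) with hr
  have hrr : √(L / k) ^ 2 * k = L := by
    rw [Real.sq_sqrt (by positivity)]; field_simp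
  have markov : ∀ r' : ℝ, μ {ω | ENNReal.ofReal (Real.exp (2 * L)) ≤
      ENNReal.ofReal (expDeviation I α X A i z r' t ω)} ≤ ENNReal.ofReal (Real.exp (-(2 * L))) := by
    intro r'
    have hmeas : Measurable fun ω => ENNReal.ofReal (expDeviation I α X A i z r' t ω) :=
      ENNReal.measurable_ofReal.comp
        ((measurable_expDeviation hA hX.adapted i z r' t).mono (ℱ.le t) le_rfl)
    refine (meas_ge_le_lintegral_div hmeas.aemeasurable (by simp [Real.exp_pos])
      ENNReal.ofReal_ne_top).trans ?_
    rw [Real.exp_neg, ENNReal.ofReal_inv_of_pos (Real.exp_pos _), ENNReal.div_eq_inv_mul]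
    exact mul_le_of_le_one_right' (lintegral_expDeviation_le_one hX hA i z r' t)
  have hsub : badEvent I α X A t i z ∩ {ω | I.numObs (A · ω) t i z = k} ⊆
      {ω | ENNReal.ofReal (Real.exp (2 * L)) ≤
        ENNReal.ofReal (expDeviation I α X A i z r t ω)} ∪
      {ω | ENNReal.ofReal (Real.exp (2 * L)) ≤
        ENNReal.ofReal (expDeviation I α X A i z (-r) t ω)} := by
    rintro ω ⟨⟨-, hω⟩, hωk⟩
    simp only [Set.mem_ofPred_eq] at hωk
    rw [hωk] at hω
    change √(L / k) < _ at hω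
    have hs := Real.sqrt_nonneg (L / k)
    simp only [Set.mem_union, Set.mem_ofPred_eq, expDeviation, hωk]
    generalize I.estimate (A · ω) (X · ω) t i z - α i z = y at hω
    rcases lt_abs.1 hω with h | h
    · left
      refine ENNReal.ofReal_le_ofReal (Real.exp_le_exp.2 ?_)
      have := mul_le_mul_of_nonneg_left h.le (mul_nonneg hs hk'.le)
      rw [hr]
      nlinarith
    · right
      refine ENNReal.ofReal_le_ofReal (Real.exp_le_exp.2 ?_)
      have := mul_le_mul_of_nonneg_left h.le (mul_nonneg hs hk'.le)
      rw [hr]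
      nlinarith
  refine ENNReal.toReal_le_of_le_ofReal (by positivity) ?_
  refine ((measure_mono hsub).trans (measure_union_le _ _)).trans ?_
  rw [two_mul (Real.exp _), ENNReal.ofReal_add (Real.exp_pos _).le (Real.exp_pos _).le]
  exact add_le_add (markov _) (markov _)

lemma measureReal_badEvent_le [IsProbabilityMeasure μ] (hX : IsEnvironment μ ℱ α X)
    (hA : ∀ t, Measurable[ℱ t] (A (t + 1))) (t : ℕ) (i : W) (z : Fin 3) :
    μ.real (badEvent I α X A t i z) ≤ 2 * (1 / ((t + 1 : ℕ) : ℝ) ^ 2) := by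
  have hcover : badEvent I α X A t i z ⊆ ⋃ k ∈ Finset.Icc 1 t,
      (badEvent I α X A t i z ∩ {ω | I.numObs (A · ω) t i z = k}) := by
    intro ω hω
    simp only [Set.mem_iUnion, Finset.mem_Icc]
    exact ⟨_, ⟨Nat.one_le_iff_ne_zero.2 hω.1, I.numObs_le _ t i z⟩, hω, rfl⟩
  have hQ : (1 : ℝ) ≤ numVars W := by
    have : 0 < Fintype.card W := Fintype.card_pos_iff.2 ⟨i⟩
    have : 1 ≤ numVars W := by simp only [numVars, Fintype.card_fin]; omega
    exact_mod_cast this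
  have hlog := Real.log_natCast_nonneg (t + 1)
  have hpos : (0 : ℝ) < (t + 1 : ℕ) := by positivity
  calc μ.real (badEvent I α X A t i z)
      ≤ ∑ k ∈ Finset.Icc 1 t,
          μ.real (badEvent I α X A t i z ∩ {ω | I.numObs (A · ω) t i z = k}) :=
        (measureReal_mono hcover (measure_ne_top _ _)).trans (measureReal_biUnion_finset_le _ _)
    _ ≤ ∑ k ∈ Finset.Icc 1 t,
          2 * Real.exp (-(2 * (((numVars W : ℝ) + 1) * Real.log (t + 1 : ℕ)))) :=
        Finset.sum_le_sum fun k hk => measureReal_badEvent_inter_le hX hA t i z k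
          (by have := (Finset.mem_Icc.1 hk).1; omega)
    _ ≤ ∑ k ∈ Finset.Icc 1 t, 2 * (1 / ((t + 1 : ℕ) : ℝ) ^ 3) := by
        refine Finset.sum_le_sum fun k _ => ?_
        have : Real.exp (-(3 * Real.log (t + 1 : ℕ))) = 1 / ((t + 1 : ℕ) : ℝ) ^ 3 := by
          rw [Real.exp_neg, mul_comm, Real.exp_mul, Real.exp_log hpos, one_div]
          norm_cast
        rw [← this]
        refine mul_le_mul_of_nonneg_left (Real.exp_le_exp.2 ?_) zero_le_two
        nlinarith
    _ = t * (2 * (1 / ((t + 1 : ℕ) : ℝ) ^ 3)) := by simp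
    _ ≤ ((t + 1 : ℕ) : ℝ) * (2 * (1 / ((t + 1 : ℕ) : ℝ) ^ 3)) := by gcongr; omega
    _ = 2 * (1 / ((t + 1 : ℕ) : ℝ) ^ 2) := by field_simp

end

end

/-! ### Counting suboptimal rounds -/

section

variable {W S P Ω : Type*} [Fintype W] [Fintype S] [PseudoMetricSpace P]

open Classical in
omit [Fintype W] [Fintype S] [PseudoMetricSpace P] in
/-- A variable is observed at most `L` times while it has fewer than `L` observations. -/
lemma Instance.sum_observed_and_numObs_lt (I : Instance W S P) (a : ℕ → Action W S) (L : ℕ) (i : W)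
    (z : Fin 3) (t : ℕ) :
    ∑ s ∈ Finset.range t, (if I.Observed (a (s + 1)) i z ∧ I.numObs a s i z < L then 1 else 0) ≤
      min (I.numObs a t i z) L := by
  induction t with
  | zero => simp
  | succ t ih =>
    rw [Finset.sum_range_succ, numObs]
    split_ifs with h1 h2 h2
    · omega
    · exact absurd h1.1 h2
    · omega
    · omega

open Classical in
/-- In a round in which CARS plays a suboptimal action, it recommends a variable with few
observations or some estimate is inaccurate. -/
lemma gap_le_of_maximal [MeasurableSpace Ω] (I : Instance W S P) (α : W → Fin 3 → ℝ)
    {ℱ : Filtration ℕ ‹MeasurableSpace Ω›} {X : ℕ → Ω → W → Fin 3 → ℝ} {A : ℕ → Ω → Action W S}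
    (hA : IsCARS I ℱ X A) {s t L : ℕ} (hst : s < t)
    (hL : 4 * (numVars W : ℝ) ^ 2 * ((numVars W : ℝ) + 1) * Real.log t / I.gapMin α ^ 2 ≤ L)
    (hL0 : 0 < L) (ω : Ω) :
    I.optReward α - I.reward α (A (s + 1) ω) ≤ I.gapMax α *
      (∑ i, ∑ z, ((if I.Observed (A (s + 1) ω) i z ∧ I.numObs (A · ω) s i z < L
        then 1 else 0 : ℕ) : ℝ) + ∑ i, ∑ z, (badEvent I α X A s i z).indicator 1 ω) := by
  have hfeas := hA.feasible s ω
  have nn1 : ∀ i z, (0 : ℝ) ≤ ((if I.Observed (A (s + 1) ω) i z ∧ I.numObs (A · ω) s i z < L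
      then 1 else 0 : ℕ) : ℝ) := fun i z => Nat.cast_nonneg _
  have nn2 : ∀ i z, (0 : ℝ) ≤ (badEvent I α X A s i z).indicator 1 ω := fun i z =>
    Set.indicator_nonneg (fun _ _ => zero_le_one) _
  have hle1 : ∀ f : W → Fin 3 → ℝ, (∀ i z, 0 ≤ f i z) → ∀ i z, f i z ≤ ∑ i, ∑ z, f i z :=
    fun f hf i z => (Finset.single_le_sum (fun z _ => hf i z) (Finset.mem_univ z)).trans
      (Finset.single_le_sum (f := fun i => ∑ z, f i z)
        (fun i _ => Finset.sum_nonneg fun z _ => hf i z) (Finset.mem_univ i))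
  have s1 := Finset.sum_nonneg fun i (_ : i ∈ Finset.univ) =>
    Finset.sum_nonneg fun z (_ : z ∈ Finset.univ) => nn1 i z
  have s2 := Finset.sum_nonneg fun i (_ : i ∈ Finset.univ) =>
    Finset.sum_nonneg fun z (_ : z ∈ Finset.univ) => nn2 i z
  rcases lt_or_ge (I.reward α (A (s + 1) ω)) (I.optReward α) with hlt | hge
  · have hgap := I.le_gapMax α hfeas hlt
    refine hgap.trans (le_mul_of_one_le_right (by linarith) ?_)
    by_contra! hcon
    refine hlt.not_ge (I.optReward_le_of_maximal α _ _ (s + 1) hfeas (hA.maximal s ω) ?_ ?_)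
    · intro i z hobs
      have h1 : L ≤ I.numObs (A · ω) s i z := by
        by_contra! h
        have := hle1 _ nn1 i z
        rw [if_pos ⟨hobs, h⟩, Nat.cast_one] at this
        linarith
      refine ⟨by omega, le_trans ?_ (hL.trans (Nat.cast_le.2 h1))⟩
      gcongr
      omega
    · intro i z hm
      by_contra! h
      have := hle1 _ nn2 i z
      rw [Set.indicator_of_mem (show ω ∈ badEvent I α X A s i z from ⟨hm, h⟩), Pi.one_apply] at this
      linarith
  · have heq := (I.reward_le_optReward α hfeas).antisymm hge
    rw [heq, sub_self]
    refine mul_nonneg (Real.sSup_nonneg ?_) (by linarith)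
    rintro d ⟨a, -, h, rfl⟩
    linarith

/-! ### The regret -/

section

variable [MeasurableSpace Ω] {μ : Measure Ω} [IsProbabilityMeasure μ] {I : Instance W S P}
  {ℱ : Filtration ℕ ‹MeasurableSpace Ω›} {α : W → Fin 3 → ℝ} {X : ℕ → Ω → W → Fin 3 → ℝ}
  {A : ℕ → Ω → Action W S}

lemma IsCARS.measurable_entry (hA : IsCARS I ℱ X A) (s : ℕ) (i : W) (j : S) :
    Measurable[ℱ s] fun ω => (A (s + 1) ω i j : ℝ) :=
  (measurable_from_top (f := ((↑) : ℕ → ℝ))).comp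
    ((measurable_pi_apply j).comp ((measurable_pi_apply i).comp (hA.predictable s)))

lemma IsCARS.integrable_entry (hA : IsCARS I ℱ X A) (s : ℕ) (i : W) (j : S) :
    Integrable (fun ω => (A (s + 1) ω i j : ℝ)) μ := by
  refine Integrable.of_bound
    ((hA.measurable_entry s i j).mono (ℱ.le s) le_rfl).aestronglyMeasurable 1
    (.of_forall fun ω => ?_)
  rcases (hA.feasible s ω).binary i j with h | h <;> simp [h]

omit [PseudoMetricSpace P] [Fintype S] [Fintype W] in
lemma IsEnvironment.integrable (hX : IsEnvironment μ ℱ α X) (s : ℕ) (i : W) (z : Fin 3) :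
    Integrable (fun ω => X (s + 1) ω i z) μ := by
  have hm : Measurable fun ω => X (s + 1) ω i z :=
    (measurable_pi_apply z).comp
      ((measurable_pi_apply i).comp ((hX.adapted s).mono (ℱ.le _) le_rfl))
  refine Integrable.of_bound hm.aestronglyMeasurable 1 (.of_forall fun ω => ?_)
  rw [Real.norm_eq_abs, abs_of_nonneg (hX.mem_Icc s ω i z).1]
  exact (hX.mem_Icc s ω i z).2

omit [IsProbabilityMeasure μ] in
lemma indepFun_entry (hX : IsEnvironment μ ℱ α X) (hA : IsCARS I ℱ X A) (s : ℕ) (i : W) (j : S)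
    (z : Fin 3) : IndepFun (fun ω => (A (s + 1) ω i j : ℝ)) (fun ω => X (s + 1) ω i z) μ := by
  have h1 : MeasurableSpace.comap (fun ω => (A (s + 1) ω i j : ℝ)) inferInstance ≤ ℱ s :=
    (hA.measurable_entry s i j).comap_le
  have h2 : MeasurableSpace.comap (fun ω => X (s + 1) ω i z) inferInstance ≤
      MeasurableSpace.comap (X (s + 1)) inferInstance := by
    have : Measurable fun x : W → Fin 3 → ℝ => x i z := by fun_prop
    exact (this.comp (comap_measurable (X (s + 1)))).comap_le
  exact indep_of_indep_of_le_left (indep_of_indep_of_le_right (hX.indep s).symm h2) h1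

lemma integrable_reward (hX : IsEnvironment μ ℱ α X) (hA : IsCARS I ℱ X A) (s : ℕ) :
    Integrable (fun ω => I.reward (X (s + 1) ω) (A (s + 1) ω)) μ :=
  integrable_finsetSum _ fun i _ => integrable_finsetSum _ fun j _ =>
    (indepFun_entry hX hA s i j _).integrable_mul (hA.integrable_entry s i j)
      (hX.integrable s i _)

lemma IsCARS.integrable_reward_mean (hA : IsCARS I ℱ X A) (α : W → Fin 3 → ℝ) (s : ℕ) :
    Integrable (fun ω => I.reward α (A (s + 1) ω)) μ :=
  integrable_finsetSum _ fun i _ => integrable_finsetSum _ fun j _ =>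
    (hA.integrable_entry s i j).mul_const _

/-- The expected reward of a round is that of its action under the means, because the action is
chosen independently of the preference values of the round. -/
lemma integral_reward (hX : IsEnvironment μ ℱ α X) (hA : IsCARS I ℱ X A) (s : ℕ) :
    ∫ ω, I.reward (X (s + 1) ω) (A (s + 1) ω) ∂μ = ∫ ω, I.reward α (A (s + 1) ω) ∂μ := by
  have h1 : ∀ i j, Integrable (fun ω => (A (s + 1) ω i j : ℝ) * X (s + 1) ω i (I.task j).kind) μ :=
    fun i j => (indepFun_entry hX hA s i j _).integrable_mul (hA.integrable_entry s i j)
      (hX.integrable s i _)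
  have h2 : ∀ i j, Integrable (fun ω => (A (s + 1) ω i j : ℝ) * α i (I.task j).kind) μ :=
    fun i j => (hA.integrable_entry s i j).mul_const _
  simp only [Instance.reward]
  rw [integral_finsetSum _ fun i _ => integrable_finsetSum _ fun j _ => h1 i j,
    integral_finsetSum _ fun i _ => integrable_finsetSum _ fun j _ => h2 i j]
  refine Finset.sum_congr rfl fun i _ => ?_
  rw [integral_finsetSum _ fun j _ => h1 i j, integral_finsetSum _ fun j _ => h2 i j]
  refine Finset.sum_congr rfl fun j _ => ?_
  rw [(indepFun_entry hX hA s i j _).integral_fun_mul_eq_mul_integral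
    (hA.integrable_entry s i j).aestronglyMeasurable (hX.integrable s i _).aestronglyMeasurable,
    hX.mean, integral_mul_const]

/-- The regret is the expected sum of the gaps of the actions played. -/
lemma regret_eq_integral_sum (hX : IsEnvironment μ ℱ α X) (hA : IsCARS I ℱ X A) (t : ℕ) :
    regret I μ α X A t =
      ∫ ω, ∑ s ∈ Finset.range t, (I.optReward α - I.reward α (A (s + 1) ω)) ∂μ := by
  have hshift : ∀ f : ℕ → ℝ, ∑ s ∈ Finset.Icc 1 t, f s = ∑ s ∈ Finset.range t, f (s + 1) :=
    fun f => by
      induction t with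
      | zero => simp
      | succ t ih => rw [Finset.sum_Icc_succ_top (by omega), ih, Finset.sum_range_succ]
  have hgap : ∀ s, Integrable (fun ω => I.optReward α - I.reward α (A (s + 1) ω)) μ :=
    fun s => (integrable_const _).sub (hA.integrable_reward_mean α s)
  simp only [regret, hshift]
  rw [integral_finsetSum _ fun s _ => integrable_reward hX hA s,
    integral_finsetSum _ fun s _ => hgap s]
  simp only [integral_reward hX hA]
  rw [Finset.sum_congr rfl fun s _ =>
    integral_sub (integrable_const (I.optReward α)) (hA.integrable_reward_mean α s)]
  simp [Finset.sum_sub_distrib]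

lemma sum_one_div_sq_le (t : ℕ) :
    ∑ s ∈ Finset.range t, 1 / ((s + 1 : ℕ) : ℝ) ^ 2 ≤ Real.pi ^ 2 / 6 := by
  have h := sum_le_hasSum (Finset.range (t + 1)) (fun n _ => by positivity) hasSum_zeta_two
  rw [Finset.sum_range_succ'] at h
  simpa using h

end

end

end EUber

end

open EUber in
theorem theorem2 {W S P Ω : Type*} [Fintype W] [Fintype S] [PseudoMetricSpace P]
    [MeasurableSpace Ω] (μ : Measure Ω) [IsProbabilityMeasure μ]
    (I : EUber.Instance W S P) (ℱ : Filtration ℕ ‹MeasurableSpace Ω›)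
    (α : W → Fin 3 → ℝ) (X : ℕ → Ω → W → Fin 3 → ℝ) (A : ℕ → Ω → EUber.Action W S)
    (hX : EUber.IsEnvironment μ ℱ α X) (hA : EUber.IsCARS I ℱ X A)
    (t : ℕ) (ht : 1 ≤ t) :
    EUber.regret I μ α X A t ≤
      (4 * I.aMax ^ 2 * (EUber.numVars W : ℝ) ^ 3 * ((EUber.numVars W : ℝ) + 1) * Real.log t /
          I.gapMin α ^ 2 +
        Real.pi ^ 2 / 3 * (EUber.numVars W : ℝ) ^ 2 + (EUber.numVars W : ℝ)) * I.gapMax α := by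
  classical
  rw [regret_eq_integral_sum hX hA]
  rcases (I.gaps α).eq_empty_or_nonempty with hE | hne
  · -- Every feasible action is optimal, and `gapMax` is the supremum of the empty set.
    have h0 : ∀ s ω, I.optReward α - I.reward α (A (s + 1) ω) = 0 := fun s ω => by
      by_contra h
      have hlt := (I.reward_le_optReward α (hA.feasible s ω)).lt_of_ne (by grind)
      have : I.optReward α - I.reward α (A (s + 1) ω) ∈ I.gaps α := ⟨_, hA.feasible s ω, hlt, rfl⟩
      simp [hE] at this
    simp [h0, Instance.gapMax, hE]
  set Q : ℝ := (numVars W : ℝ) with hQdef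
  have hcard : ∀ c : ℝ, ∑ _i : W, ∑ _z : Fin 3, c = Q * c := fun c => by
    simp [hQdef, numVars, mul_assoc]
  have hlog : 0 ≤ Real.log t := Real.log_natCast_nonneg t
  set l : ℝ := 4 * Q ^ 2 * (Q + 1) * Real.log t / I.gapMin α ^ 2 with hl
  have hl0 : 0 ≤ l := by positivity
  have hgap0 : 0 ≤ I.gapMax α := by
    obtain ⟨d, a, ha, hlt, rfl⟩ := hne
    exact (sub_pos.2 hlt).le.trans (I.le_gapMax α ha hlt)
  set L : ℕ := ⌊l⌋₊ + 1
  have hlL : l ≤ L := by simpa [L] using (Nat.lt_floor_add_one l).le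
  have hLl : (L : ℝ) ≤ l + 1 := by simpa [L] using Nat.floor_le hl0
  have hpoint : ∀ ω, ∑ s ∈ Finset.range t, (I.optReward α - I.reward α (A (s + 1) ω)) ≤
      I.gapMax α * (Q * (l + 1) +
        ∑ s ∈ Finset.range t, ∑ i, ∑ z, (badEvent I α X A s i z).indicator 1 ω) := by
    intro ω
    refine (Finset.sum_le_sum fun s hs => gap_le_of_maximal I α hA (Finset.mem_range.1 hs) hlL
      (Nat.succ_pos _) ω).trans ?_
    rw [← Finset.mul_sum, Finset.sum_add_distrib]
    gcongr
    rw [Finset.sum_comm, ← hcard]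
    refine Finset.sum_le_sum fun i _ => ?_
    rw [Finset.sum_comm]
    refine Finset.sum_le_sum fun z _ => le_trans ?_ hLl
    exact_mod_cast (I.sum_observed_and_numObs_lt (A · ω) L i z t).trans (min_le_right _ _)
  have hind : ∀ s i z, Integrable ((badEvent I α X A s i z).indicator (1 : Ω → ℝ)) μ :=
    fun s i z => (integrable_const (1 : ℝ)).indicator
      (measurableSet_badEvent hA.predictable hX.adapted s i z)
  have hint : Integrable (fun ω => ∑ s ∈ Finset.range t, ∑ i, ∑ z,
      (badEvent I α X A s i z).indicator (1 : Ω → ℝ) ω) μ :=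
    integrable_finsetSum _ fun s _ => integrable_finsetSum _ fun i _ =>
      integrable_finsetSum _ fun z _ => hind s i z
  have hbad : ∫ ω, ∑ s ∈ Finset.range t, ∑ i, ∑ z,
      (badEvent I α X A s i z).indicator (1 : Ω → ℝ) ω ∂μ ≤ Real.pi ^ 2 / 3 * Q := by
    rw [integral_finsetSum _ fun s _ => integrable_finsetSum _ fun i _ =>
      integrable_finsetSum _ fun z _ => hind s i z]
    have hs : ∀ s, ∫ ω, ∑ i, ∑ z, (badEvent I α X A s i z).indicator (1 : Ω → ℝ) ω ∂μ ≤
        Q * (2 * (1 / ((s + 1 : ℕ) : ℝ) ^ 2)) := fun s => by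
      rw [integral_finsetSum _ fun i _ => integrable_finsetSum _ fun z _ => hind s i z, ← hcard]
      refine Finset.sum_le_sum fun i _ => ?_
      rw [integral_finsetSum _ fun z _ => hind s i z]
      refine Finset.sum_le_sum fun z _ => ?_
      rw [integral_indicator_one (measurableSet_badEvent hA.predictable hX.adapted s i z)]
      exact measureReal_badEvent_le hX hA.predictable s i z
    refine (Finset.sum_le_sum fun s _ => hs s).trans ?_
    rw [← Finset.mul_sum, ← Finset.mul_sum]
    have := mul_le_mul_of_nonneg_left (sum_one_div_sq_le t) (show (0 : ℝ) ≤ Q * 2 by positivity)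
    linarith
  have hQQ : Q ≤ Q ^ 2 := by
    rcases Nat.eq_zero_or_pos (numVars W) with h | h
    · simp [hQdef, h]
    · have : (1 : ℝ) ≤ Q := Nat.one_le_cast.2 h
      nlinarith
  calc ∫ ω, ∑ s ∈ Finset.range t, (I.optReward α - I.reward α (A (s + 1) ω)) ∂μ
      ≤ ∫ ω, I.gapMax α * (Q * (l + 1) + ∑ s ∈ Finset.range t, ∑ i, ∑ z,
          (badEvent I α X A s i z).indicator 1 ω) ∂μ :=
        integral_mono (integrable_finsetSum _ fun s _ =>
          (integrable_const _).sub (hA.integrable_reward_mean α s))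
          (((integrable_const _).add hint).const_mul _) hpoint
    _ = I.gapMax α * (Q * (l + 1) + ∫ ω, ∑ s ∈ Finset.range t, ∑ i, ∑ z,
          (badEvent I α X A s i z).indicator (1 : Ω → ℝ) ω ∂μ) := by
        rw [integral_const_mul, integral_add (integrable_const _) hint]
        simp
    _ ≤ I.gapMax α * (Q * (l + 1) + Real.pi ^ 2 / 3 * Q ^ 2) := by
        gcongr
        exact hbad.trans (by gcongr)
    _ = _ := by
        rw [I.aMax_eq_one α hne, hl]
        ring
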